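/- Let $\mu\in\mathbb{R}$, $\sigma>0$, $\gamma\ge 0$, $C>0$, let $X_1,X_2,\ldots$ be i.i.d. random variables with law $N(\mu,\sigma^2)$, let $L\ge 1$ be an integer and let $0<k_1<k_2<\cdots<k_{L+1}$ be natural numbers. Put $K_m=\sum_{j=1}^m X_j$ and let $\psi(x)=1$ if $|x|\ge C$ and $\psi(x)=0$ if $|x|<C$. For each $n\ge 1$ let $N_n$ be a random variable (a random sample size), defined on the same probability space, with values in $\{k_1n,\ldots,k_{L+1}n\}$, such that for each $i\in\{1,\ldots,L\}$ the event $\{N_n=k_in\}$ is independent of $(X_{k_in+1},X_{k_in+2},\ldots)$ and, almost surely, $$\mathbb{P}[N_n=k_in\mid X_1,\ldots,X_{k_in}]=\psi\!\left(\frac{K_{k_in}}{(k_in)^\gamma}\right)\prod_{j=1}^{i-1}\left(1-\psi\!\left(\frac{K_{k_jn}}{(k_jn)^\gamma}\right)\right),$$ the empty product being $1$. Let $\widehat\mu_{N_n}=K_{N_n}/N_n$ be the sample mean. Assume that $\mu\notin\{-C,C\}$ and that it is not the case that both $\gamma=1/2$ and $\mu=0$. Then $$d_{TV}\left(N(0,1),\frac{\sqrt{N_n}}{\sigma}\left(\widehat\mu_{N_n}-\mu\right)\right)\to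 0\quad\text{as } n\to\infty,$$ where $d_{TV}(Y,Z)=\sup_A|\mathbb{P}[Y\in A]-\mathbb{P}[Z\in A]|$, the supremum being over all Borel sets $A\subset\mathbb{R}$. In particular, for each $x>0$, with $\Phi$ the standard normal distribution function, $$\left|2\Phi(x)-1-\mathbb{P}\left[\widehat\mu_{N_n}-\frac{\sigma}{\sqrt{N_n}}x\le\mu\le\widehat\mu_{N_n}+\frac{\sigma}{\sqrt{N_n}}x\right]\right|\to 0\quad\text{as } n\to\infty.$$ -/

import Mathlib

open MeasureTheory ProbabilityTheory Filter Topology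

noncomputable section

/-- The partial sum `K_m = X_1 + ⋯ + X_m`; the observation `X_{j+1}` is `X j`. -/
def partialSum {Ω : Type*} (X : ℕ → Ω → ℝ) (m : ℕ) (ω : Ω) : ℝ :=
  ∑ j ∈ Finset.range m, X j ω

/-- The σ-algebra generated by the first `m` observations `X_1, …, X_m`. -/
abbrev pastSigma {Ω : Type*} (X : ℕ → Ω → ℝ) (m : ℕ) : MeasurableSpace Ω :=
  ⨆ j : ℕ, ⨆ _ : j < m, MeasurableSpace.comap (X j) inferInstance

/-- The σ-algebra generated by the later observations `X_{m+1}, X_{m+2}, …`. -/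
abbrev futureSigma {Ω : Type*} (X : ℕ → Ω → ℝ) (m : ℕ) : MeasurableSpace Ω :=
  ⨆ j : ℕ, ⨆ _ : m ≤ j, MeasurableSpace.comap (X j) inferInstance

/-- The two-sided threshold rule `ψ(x) = 1` if `|x| ≥ C` and `ψ(x) = 0` if `|x| < C`. -/
def twoSidedThreshold (C : ℝ) (x : ℝ) : ℝ :=
  open Classical in if C ≤ |x| then 1 else 0

/-- `N` is the random length of a group sequential trial of parameter `n`, with observations `X`,
interim analyses after `k 1 * n, …, k L * n` observations, maximal length `k (L + 1) * n`, stopping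
function `ψ` and shape parameter `γ`. -/
structure IsTrialLength {Ω : Type*} [MeasurableSpace Ω] (P : Measure Ω) (X : ℕ → Ω → ℝ)
    (L : ℕ) (k : ℕ → ℕ) (ψ : ℝ → ℝ) (γ : ℝ) (n : ℕ) (N : Ω → ℕ) : Prop where
  measurable : Measurable N
  /-- the possible values -/
  mem_values : ∀ ω, ∃ i ∈ Finset.Icc 1 (L + 1), N ω = k i * n
  /-- the event `{N = k_i n}` does not depend on the observations after the `i`-th analysis -/
  indep_future : ∀ i ∈ Finset.Icc 1 L,
    Indep (MeasurableSpace.generateFrom {{ω | N ω = k i * n}}) (futureSigma X (k i * n)) P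
  /-- the conditional probability of `{N = k_i n}` given the first `k_i n` observations -/
  stopping_rule : ∀ i ∈ Finset.Icc 1 L,
    P⟦{ω | N ω = k i * n} | pastSigma X (k i * n)⟧ =ᵐ[P] fun ω =>
      ψ (partialSum X (k i * n) ω / ((k i * n : ℕ) : ℝ) ^ γ) *
        ∏ j ∈ Finset.Ico 1 i,
          (1 - ψ (partialSum X (k j * n) ω / ((k j * n : ℕ) : ℝ) ^ γ))

/-- The sample mean `K_N / N` at the random time `N`. -/
def sampleMean {Ω : Type*} (X : ℕ → Ω → ℝ) (N : Ω → ℕ) (ω : Ω) : ℝ :=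
  partialSum X (N ω) ω / (N ω : ℝ)

/-- The total variation distance between two probability measures on `ℝ`,
the supremum of `|ν₁ A - ν₂ A|` over all Borel sets `A`. -/
def tvDist (ν₁ ν₂ : Measure ℝ) : ℝ :=
  ⨆ A : {A : Set ℝ // MeasurableSet A}, |ν₁.real A - ν₂.real A|

end

/-! At a deterministic time `m` the standardized mean `Z` is exactly `N(0,1)`, so it suffices that
the trial length be asymptotically deterministic. Since `K_m / m^γ = m^(1-γ) (μ + σ Z / √m)`, for
each fixed nonzero value of `Z` its modulus eventually settles on one side of `C`, and the side
depends only on `μ`, `γ`, `C` (`eventually_threshold_dichotomy`). Hence the exceedance probability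
tends to 1 or to 0, and the trial stops at the first or at the last possible time with probability
tending to 1 (`exists_tendsto_measureReal_ne`). Where the random time equals that deterministic
time, the two standardized means coincide, so the total variation distance is at most the
probability that the times differ (`abs_measureReal_map_sub_le`). -/

lemma measurable_partialSum {Ω : Type*} [MeasurableSpace Ω] {X : ℕ → Ω → ℝ}
    (hX : ∀ j, Measurable (X j)) (m : ℕ) : Measurable (partialSum X m) :=
  Finset.measurable_fun_sum _ fun j _ => hX j

lemma pastSigma_le {Ω : Type*} [mΩ : MeasurableSpace Ω] {X : ℕ → Ω → ℝ}
    (hX : ∀ j, Measurable (X j)) (m : ℕ) : pastSigma X m ≤ mΩ :=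
  iSup₂_le fun j _ => (hX j).comap_le

lemma map_partialSum_eq_gaussianReal {Ω : Type*} [MeasurableSpace Ω] {P : Measure Ω}
    [IsProbabilityMeasure P] {X : ℕ → Ω → ℝ} {μ : ℝ} {v : NNReal}
    (hX_meas : ∀ j, Measurable (X j)) (hX_indep : iIndepFun X P)
    (hX_law : ∀ j, P.map (X j) = gaussianReal μ v) (m : ℕ) :
    P.map (partialSum X m) = gaussianReal (m * μ) (m * v) := by
  induction m with
  | zero =>
    have : partialSum X 0 = fun _ => 0 := by ext; simp [partialSum]
    simp [this, gaussianReal_zero_var, Measure.map_const]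
  | succ m ih =>
    have hsum : partialSum X (m + 1) = partialSum X m + X m := by
      ext ω; simp [partialSum, Finset.sum_range_succ]
    have hind : IndepFun (partialSum X m) (X m) P := by
      have := hX_indep.indepFun_finsetSum_of_notMem hX_meas (s := Finset.range m) (i := m)
        (by simp)
      convert this using 1
      ext ω; simp [partialSum]
    rw [hsum, gaussianReal_add_gaussianReal_of_indepFun hind ih (hX_law m)]
    congr 1 <;> push_cast <;> ring

/-- The standardized mean `√m / σ * (K_m / m - μ)` of the first `m` observations. -/
noncomputable def standardizedMean {Ω : Type*} (X : ℕ → Ω → ℝ) (μ σ : ℝ) (m : ℕ) (ω : Ω) : ℝ :=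
  Real.sqrt m / σ * (partialSum X m ω / m - μ)

lemma measurable_standardizedMean {Ω : Type*} [MeasurableSpace Ω] {X : ℕ → Ω → ℝ}
    (hX : ∀ j, Measurable (X j)) (μ σ : ℝ) (m : ℕ) : Measurable (standardizedMean X μ σ m) :=
  (((measurable_partialSum hX m).div_const _).sub_const _).const_mul _

lemma partialSum_eq_standardizedMean {Ω : Type*} (X : ℕ → Ω → ℝ) (μ : ℝ) {σ : ℝ} (hσ : 0 < σ)
    {m : ℕ} (hm : 0 < m) (ω : Ω) :
    partialSum X m ω = m * (μ + σ * standardizedMean X μ σ m ω / Real.sqrt m) := by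
  have hm' : (0 : ℝ) < m := by exact_mod_cast hm
  have := Real.sqrt_pos.2 hm'
  unfold standardizedMean
  field_simp
  ring

lemma map_standardizedMean {Ω : Type*} [MeasurableSpace Ω] {P : Measure Ω}
    [IsProbabilityMeasure P] {X : ℕ → Ω → ℝ} {μ σ : ℝ} (hσ : 0 < σ)
    (hX_meas : ∀ j, Measurable (X j)) (hX_indep : iIndepFun X P)
    (hX_law : ∀ j, P.map (X j) = gaussianReal μ (σ ^ 2).toNNReal) {m : ℕ} (hm : 0 < m) :
    P.map (standardizedMean X μ σ m) = gaussianReal 0 1 := by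
  have hm' : (0 : ℝ) < m := by exact_mod_cast hm
  have h0 : HasLaw (partialSum X m) (gaussianReal (m * μ) (m * (σ ^ 2).toNNReal)) P :=
    ⟨(measurable_partialSum hX_meas m).aemeasurable,
      map_partialSum_eq_gaussianReal hX_meas hX_indep hX_law m⟩
  have h := (gaussianReal_const_mul (gaussianReal_sub_const (gaussianReal_div_const h0 m) μ)
    (Real.sqrt m / σ)).map_eq
  refine Eq.trans h ?_
  congr 1
  · field_simp
    ring
  · ext
    simp only [NNReal.coe_mul, NNReal.coe_div, NNReal.coe_mk, NNReal.coe_natCast, NNReal.coe_one,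
      Real.coe_toNNReal _ (sq_nonneg σ), div_pow, Real.sq_sqrt hm'.le]
    field_simp

/-! ### Limiting behaviour of the exceedance probability -/

/-- For all `z ≠ 0`, the ratio between the partial sum corresponding to the standardized value `z`
and `m ^ γ` eventually stays on the same side of the threshold, which does not depend on `z`. -/
lemma eventually_threshold_dichotomy {μ σ γ C : ℝ} (hσ : 0 < σ) (hC : 0 < C)
    (hμC : μ ∉ ({-C, C} : Set ℝ)) (hγμ : ¬ (γ = 1 / 2 ∧ μ = 0)) :
    (∀ z : ℝ, z ≠ 0 → ∀ᶠ t : ℝ in atTop, C ≤ |t * (μ + σ * z / Real.sqrt t) / t ^ γ|) ∨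
    (∀ z : ℝ, z ≠ 0 → ∀ᶠ t : ℝ in atTop, |t * (μ + σ * z / Real.sqrt t) / t ^ γ| < C) := by
  have hlim (z : ℝ) : Tendsto (fun t : ℝ => |μ + σ * z / Real.sqrt t|) atTop (𝓝 |μ|) := by
    simpa using ((Real.tendsto_sqrt_atTop.const_div_atTop (σ * z)).const_add μ).abs
  have heq (z : ℝ) : (fun t : ℝ => |t * (μ + σ * z / Real.sqrt t) / t ^ γ|) =ᶠ[atTop]
      fun t => t ^ (1 - γ) * |μ + σ * z / Real.sqrt t| := by
    filter_upwards [eventually_gt_atTop 0] with t ht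
    rw [abs_div, abs_mul, abs_of_pos ht, abs_of_pos (Real.rpow_pos_of_pos ht γ),
      Real.rpow_sub ht, Real.rpow_one]
    ring
  -- Without drift only the fluctuation of order `√t` remains, so the critical exponent drops from 1
  -- to 1/2.
  have heq0 (hμ : μ = 0) (z : ℝ) : (fun t : ℝ => |t * (μ + σ * z / Real.sqrt t) / t ^ γ|)
      =ᶠ[atTop] fun t => t ^ (1 / 2 - γ) * |σ * z| := by
    filter_upwards [heq z, eventually_gt_atTop 0] with t h ht
    have h2 : t ^ (1 - γ) = t ^ (1 / 2 - γ) * Real.sqrt t := by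
      rw [Real.sqrt_eq_rpow, ← Real.rpow_add ht]
      ring_nf
    have := Real.sqrt_pos.2 ht
    rw [h, h2, hμ, zero_add, abs_div, abs_of_pos this]
    field_simp
  have hge {f g : ℝ → ℝ} (hfg : f =ᶠ[atTop] g) (hg : Tendsto g atTop atTop) :
      ∀ᶠ t in atTop, C ≤ f t := by
    filter_upwards [hfg, hg.eventually_ge_atTop C] with t h1 h2 using h1 ▸ h2
  have hlt {f g : ℝ → ℝ} {a : ℝ} (ha : a < C) (hfg : f =ᶠ[atTop] g)
      (hg : Tendsto g atTop (𝓝 a)) : ∀ᶠ t in atTop, f t < C := by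
    filter_upwards [hfg, hg.eventually_lt_const ha] with t h1 h2 using h1 ▸ h2
  have hzero {a : ℝ} (ha : a < 0) : Tendsto (fun t : ℝ => t ^ a) atTop (𝓝 0) := by
    simpa using tendsto_rpow_neg_atTop (neg_pos.2 ha)
  by_cases hμ : μ = 0
  · have hγ : γ ≠ 1 / 2 := fun h => hγμ ⟨h, hμ⟩
    rcases lt_or_gt_of_ne hγ with h | h
    · exact .inl fun z hz => hge (heq0 hμ z)
        ((tendsto_rpow_atTop (sub_pos.2 h)).atTop_mul_const (abs_pos.2 (mul_ne_zero hσ.ne' hz)))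
    · exact .inr fun z _ => hlt hC (heq0 hμ z)
        (by simpa using (hzero (sub_neg.2 h)).mul_const |σ * z|)
  rcases lt_trichotomy γ 1 with h | h | h
  · exact .inl fun z _ => hge (heq z)
      ((tendsto_rpow_atTop (sub_pos.2 h)).atTop_mul_pos (abs_pos.2 hμ) (hlim z))
  -- At the critical exponent 1 the limit is `|μ|`; this is where `|μ| ≠ C` is needed.
  · have hmul (z : ℝ) : Tendsto (fun t : ℝ => t ^ (1 - γ) * |μ + σ * z / Real.sqrt t|) atTop
        (𝓝 |μ|) := by simpa [h] using hlim z
    have hne : |μ| ≠ C := fun h' => hμC <| by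
      rcases (abs_eq hC.le).1 h' with h' | h' <;> simp [h']
    rcases lt_or_gt_of_ne hne with h' | h'
    · exact .inr fun z _ => hlt h' (heq z) (hmul z)
    · refine .inl fun z _ => ?_
      filter_upwards [heq z, (hmul z).eventually_const_lt h'] with t h1 h2 using h1 ▸ h2.le
  · exact .inr fun z _ => hlt hC (heq z)
      (by simpa using (hzero (sub_neg.2 h)).mul (hlim z))

/-- The probability that the threshold is exceeded after `m` observations. -/
noncomputable def exceedanceProb {Ω : Type*} [MeasurableSpace Ω] (P : Measure Ω) (X : ℕ → Ω → ℝ) (γ C : ℝ)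
    (m : ℕ) : ℝ :=
  P.real {ω | C ≤ |partialSum X m ω / (m : ℝ) ^ γ|}

lemma tendsto_exceedanceProb {Ω : Type*} [MeasurableSpace Ω] {P : Measure Ω}
    [IsProbabilityMeasure P] {X : ℕ → Ω → ℝ} {μ σ γ C : ℝ} (hσ : 0 < σ)
    (hX_meas : ∀ j, Measurable (X j)) (hX_indep : iIndepFun X P)
    (hX_law : ∀ j, P.map (X j) = gaussianReal μ (σ ^ 2).toNNReal) (hC : 0 < C)
    (hμC : μ ∉ ({-C, C} : Set ℝ)) (hγμ : ¬ (γ = 1 / 2 ∧ μ = 0)) :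
    Tendsto (exceedanceProb P X γ C) atTop (𝓝 1) ∨
      Tendsto (exceedanceProb P X γ C) atTop (𝓝 0) := by
  set S : ℕ → Set ℝ := fun m => {z | C ≤ |m * (μ + σ * z / Real.sqrt m) / (m : ℝ) ^ γ|} with hS
  have hSm (m : ℕ) : MeasurableSet (S m) := measurableSet_le measurable_const (by fun_prop)
  have hprob : exceedanceProb P X γ C =ᶠ[atTop] fun m => (gaussianReal 0 1).real (S m) := by
    filter_upwards [eventually_gt_atTop 0] with m hm
    rw [← map_standardizedMean hσ hX_meas hX_indep hX_law hm, map_measureReal_apply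
      (measurable_standardizedMean hX_meas μ σ m) (hSm m), exceedanceProb]
    congr 1
    ext ω
    simp only [hS, Set.mem_ofPred_eq, Set.mem_preimage,
      ← partialSum_eq_standardizedMean X μ hσ hm ω]
  -- The point `z = 0` must be discarded: for `μ = 0` the ratio vanishes there, even when `γ < 1/2`.
  have hae : ∀ᵐ z ∂gaussianReal 0 1, z ≠ 0 := by
    have := nullSingletonClass_gaussianReal (μ := 0) (v := 1) one_ne_zero
    rw [ae_iff]
    simp
  rcases eventually_threshold_dichotomy hσ hC hμC hγμ with h | h
  · left
    refine Tendsto.congr' hprob.symm ?_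
    have := tendsto_measure_of_ae_tendsto_indicator_of_isFiniteMeasure atTop
      (μ := gaussianReal 0 1) MeasurableSet.univ hSm (by
        filter_upwards [hae] with z hz
        filter_upwards [tendsto_natCast_atTop_atTop.eventually (h z hz)] with m hm
        simpa [hS] using hm)
    simpa [Measure.real, Function.comp_def] using (ENNReal.tendsto_toReal (by simp)).comp this
  · right
    refine Tendsto.congr' hprob.symm ?_
    have := tendsto_measure_of_ae_tendsto_indicator_of_isFiniteMeasure atTop
      (μ := gaussianReal 0 1) MeasurableSet.empty hSm (by
        filter_upwards [hae] with z hz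
        filter_upwards [tendsto_natCast_atTop_atTop.eventually (h z hz)] with m hm
        simpa [hS] using hm)
    simpa [Measure.real, Function.comp_def] using (ENNReal.tendsto_toReal (by simp)).comp this

/-! ### Distribution of the trial length -/

lemma twoSidedThreshold_nonneg (C x : ℝ) : 0 ≤ twoSidedThreshold C x := by
  unfold twoSidedThreshold; split_ifs <;> norm_num

lemma twoSidedThreshold_le_one (C x : ℝ) : twoSidedThreshold C x ≤ 1 := by
  unfold twoSidedThreshold; split_ifs <;> norm_num

lemma integral_twoSidedThreshold {Ω : Type*} [MeasurableSpace Ω] (P : Measure Ω)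
    [IsProbabilityMeasure P] {X : ℕ → Ω → ℝ} (hX_meas : ∀ j, Measurable (X j)) (γ C : ℝ) (m : ℕ) :
    ∫ ω, twoSidedThreshold C (partialSum X m ω / (m : ℝ) ^ γ) ∂P = exceedanceProb P X γ C m := by
  have hm : MeasurableSet {ω | C ≤ |partialSum X m ω / (m : ℝ) ^ γ|} := by
    have := measurable_partialSum hX_meas m
    exact measurableSet_le measurable_const (by fun_prop)
  rw [exceedanceProb, ← integral_indicator_one hm]
  congr 1

namespace IsTrialLength

variable {Ω : Type*} [MeasurableSpace Ω] {P : Measure Ω} [IsProbabilityMeasure P]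
  {X : ℕ → Ω → ℝ} {L : ℕ} {k : ℕ → ℕ} {γ C : ℝ} {n : ℕ} {N : Ω → ℕ}

/-- Integrating the stopping rule removes the conditioning. -/
lemma measureReal_eq_integral {ψ : ℝ → ℝ} (h : IsTrialLength P X L k ψ γ n N)
    (hX_meas : ∀ j, Measurable (X j)) {i : ℕ} (hi : i ∈ Finset.Icc 1 L) :
    P.real {ω | N ω = k i * n} =
      ∫ ω, ψ (partialSum X (k i * n) ω / ((k i * n : ℕ) : ℝ) ^ γ) *
        ∏ j ∈ Finset.Ico 1 i,
          (1 - ψ (partialSum X (k j * n) ω / ((k j * n : ℕ) : ℝ) ^ γ)) ∂P := by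
  have hs : MeasurableSet {ω | N ω = k i * n} := h.measurable (measurableSet_singleton _)
  rw [← integral_congr_ae (h.stopping_rule i hi), integral_condExp (pastSigma_le hX_meas _)]
  exact (integral_indicator_one hs).symm

lemma measureReal_first (h : IsTrialLength P X L k (twoSidedThreshold C) γ n N)
    (hX_meas : ∀ j, Measurable (X j)) (hL : 1 ≤ L) :
    P.real {ω | N ω = k 1 * n} = exceedanceProb P X γ C (k 1 * n) := by
  rw [h.measureReal_eq_integral hX_meas (by simpa using hL), ← integral_twoSidedThreshold P hX_meas]
  simp

/-- The product over the earlier analyses has factors in `[0, 1]`, so dropping it only increases the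
integral. -/
lemma measureReal_le (h : IsTrialLength P X L k (twoSidedThreshold C) γ n N)
    (hX_meas : ∀ j, Measurable (X j)) {i : ℕ} (hi : i ∈ Finset.Icc 1 L) :
    P.real {ω | N ω = k i * n} ≤ exceedanceProb P X γ C (k i * n) := by
  have hψ : Measurable (twoSidedThreshold C) :=
    Measurable.ite (measurableSet_le measurable_const (by fun_prop)) measurable_const
      measurable_const
  rw [h.measureReal_eq_integral hX_meas hi, ← integral_twoSidedThreshold P hX_meas]
  refine integral_mono_of_nonneg (ae_of_all _ fun ω => ?_) ?_ (ae_of_all _ fun ω => ?_)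
  · exact mul_nonneg (twoSidedThreshold_nonneg _ _) (Finset.prod_nonneg fun j _ =>
      sub_nonneg.2 (twoSidedThreshold_le_one _ _))
  · refine Integrable.of_bound (C := 1)
      (hψ.comp ((measurable_partialSum hX_meas _).div_const _)).aestronglyMeasurable
      (ae_of_all _ fun ω => ?_)
    rw [Real.norm_of_nonneg (twoSidedThreshold_nonneg _ _)]
    exact twoSidedThreshold_le_one _ _
  · refine mul_le_of_le_one_right (twoSidedThreshold_nonneg _ _) (Finset.prod_le_one
      (fun j _ => sub_nonneg.2 (twoSidedThreshold_le_one _ _)) fun j _ =>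
      sub_le_self _ (twoSidedThreshold_nonneg _ _))

lemma measureReal_ne_last_le (h : IsTrialLength P X L k (twoSidedThreshold C) γ n N)
    (hX_meas : ∀ j, Measurable (X j)) :
    P.real {ω | N ω ≠ k (L + 1) * n} ≤
      ∑ i ∈ Finset.Icc 1 L, exceedanceProb P X γ C (k i * n) := by
  have hsub : {ω | N ω ≠ k (L + 1) * n} ⊆ ⋃ i ∈ Finset.Icc 1 L, {ω | N ω = k i * n} := by
    intro ω hω
    obtain ⟨i, hi, hNi⟩ := h.mem_values ω
    simp only [Finset.mem_Icc, Set.mem_iUnion, Set.mem_ofPred_eq] at hi ⊢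
    have hne : i ≠ L + 1 := fun h' => hω (h' ▸ hNi)
    exact ⟨i, ⟨hi.1, by omega⟩, hNi⟩
  exact (measureReal_mono hsub (measure_ne_top _ _)).trans ((measureReal_biUnion_finset_le _ _).trans
    (Finset.sum_le_sum fun i hi => h.measureReal_le hX_meas hi))

end IsTrialLength

lemma strictMonoOn_Icc_one_pos {k : ℕ → ℕ} {l : ℕ} (hk_pos : 0 < k 1)
    (hk_mono : StrictMonoOn k (Set.Icc 1 l)) {i : ℕ} (hi : i ∈ Finset.Icc 1 l) : 0 < k i := by
  have hi' := Finset.mem_Icc.1 hi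
  exact hk_pos.trans_le (hk_mono.monotoneOn ⟨le_rfl, hi'.1.trans hi'.2⟩ hi' hi'.1)

/-- The length of the trial is asymptotically deterministic. -/
lemma exists_tendsto_measureReal_ne {Ω : Type*} [MeasurableSpace Ω] {P : Measure Ω}
    [IsProbabilityMeasure P] {μ σ : ℝ} (hσ : 0 < σ)
    {X : ℕ → Ω → ℝ} (hX_meas : ∀ j, Measurable (X j)) (hX_indep : iIndepFun X P)
    (hX_law : ∀ j, P.map (X j) = gaussianReal μ (σ ^ 2).toNNReal)
    {L : ℕ} (hL : 1 ≤ L)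
    {k : ℕ → ℕ} (hk_pos : 0 < k 1) (hk_mono : StrictMonoOn k (Set.Icc 1 (L + 1)))
    {γ C : ℝ} (hC : 0 < C) (hμC : μ ∉ ({-C, C} : Set ℝ)) {N : ℕ → Ω → ℕ}
    (hN : ∀ n : ℕ, 1 ≤ n → IsTrialLength P X L k (twoSidedThreshold C) γ n (N n))
    (hγμ : ¬ (γ = 1 / 2 ∧ μ = 0)) :
    ∃ i ∈ Finset.Icc 1 (L + 1),
      Tendsto (fun n => P.real {ω | N n ω ≠ k i * n}) atTop (𝓝 0) := by
  have hatTop {i : ℕ} (hi : i ∈ Finset.Icc 1 (L + 1)) : Tendsto (fun n => k i * n) atTop atTop :=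
    tendsto_id.const_mul_atTop' (strictMonoOn_Icc_one_pos hk_pos hk_mono hi)
  rcases tendsto_exceedanceProb hσ hX_meas hX_indep hX_law hC hμC hγμ with h | h
  -- Exceedance is almost certain, so the trial stops at the first analysis.
  · have h1 : 1 ∈ Finset.Icc 1 (L + 1) := by simp
    refine ⟨1, h1, ?_⟩
    have hlim : Tendsto (fun n => 1 - exceedanceProb P X γ C (k 1 * n)) atTop (𝓝 0) := by
      simpa using (h.comp (hatTop h1)).const_sub 1
    refine hlim.congr' ?_
    filter_upwards [eventually_ge_atTop 1] with n hn
    rw [← (hN n hn).measureReal_first hX_meas hL]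
    exact (probReal_compl_eq_one_sub ((hN n hn).measurable (measurableSet_singleton _))).symm
  -- Exceedance is unlikely at each of the `L` analyses, so by the union bound the trial runs to its
  -- maximal length.
  · refine ⟨L + 1, by simp, ?_⟩
    have hlim : Tendsto (fun n => ∑ i ∈ Finset.Icc 1 L, exceedanceProb P X γ C (k i * n))
        atTop (𝓝 0) := by
      rw [← Finset.sum_const_zero (s := Finset.Icc 1 L)]
      exact tendsto_finsetSum _ fun i hi =>
        h.comp (hatTop (Finset.Icc_subset_Icc_right (Nat.le_succ L) hi))
    refine squeeze_zero' (Eventually.of_forall fun n => measureReal_nonneg) ?_ hlim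
    filter_upwards [eventually_ge_atTop 1] with n hn
    exact (hN n hn).measureReal_ne_last_le hX_meas

/-! ### Total variation bound and confidence intervals -/

/-- The coupling inequality: the events `S ∈ A` and `T ∈ A` can differ only inside `E`. -/
lemma abs_measureReal_map_sub_le {Ω : Type*} [MeasurableSpace Ω] {P : Measure Ω}
    [IsProbabilityMeasure P] {S T : Ω → ℝ} (hS : Measurable S) (hT : Measurable T)
    {E : Set Ω} (hST : ∀ ω ∉ E, S ω = T ω) {A : Set ℝ} (hA : MeasurableSet A) :
    |(P.map S).real A - (P.map T).real A| ≤ P.real E := by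
  rw [map_measureReal_apply hS hA, map_measureReal_apply hT hA, abs_sub_le_iff]
  constructor
  · rw [sub_le_iff_le_add']
    refine (measureReal_mono ?_).trans (measureReal_union_le _ _)
    intro ω hω
    by_cases hE : ω ∈ E
    · exact .inr hE
    · exact .inl (by simpa [hST ω hE] using hω)
  · rw [sub_le_iff_le_add']
    refine (measureReal_mono ?_).trans (measureReal_union_le _ _)
    intro ω hω
    by_cases hE : ω ∈ E
    · exact .inr hE
    · exact .inl (by simpa [hST ω hE] using hω)

lemma measurable_sampleMean {Ω : Type*} [MeasurableSpace Ω] {X : ℕ → Ω → ℝ} {N : Ω → ℕ}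
    (hX : ∀ j, Measurable (X j)) (hN : Measurable N) : Measurable (sampleMean X N) := by
  -- Joint measurability is automatic because the time ranges over a countable set.
  have h : Measurable fun p : ℕ × Ω => partialSum X p.1 p.2 :=
    measurable_from_prod_countable_right fun m => measurable_partialSum hX m
  exact (h.comp (hN.prodMk measurable_id)).div (measurable_from_nat.comp hN)

lemma tvDist_nonneg (ν₁ ν₂ : Measure ℝ) : 0 ≤ tvDist ν₁ ν₂ :=
  Real.iSup_nonneg fun _ => abs_nonneg _

lemma tvDist_le {ν₁ ν₂ : Measure ℝ} {b : ℝ}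
    (h : ∀ A, MeasurableSet A → |ν₁.real A - ν₂.real A| ≤ b) : tvDist ν₁ ν₂ ≤ b :=
  haveI : Nonempty {A : Set ℝ // MeasurableSet A} := ⟨⟨∅, .empty⟩⟩
  ciSup_le fun A => h A.1 A.2

lemma gaussianReal_zero_one_real_Icc {x : ℝ} (hx : 0 < x) :
    (gaussianReal 0 1).real (Set.Icc (-x) x) = 2 * cdf (gaussianReal 0 1) x - 1 := by
  have := nullSingletonClass_gaussianReal (μ := 0) (v := 1) one_ne_zero
  have hneg : (gaussianReal 0 1).real (Set.Iio (-x)) = (gaussianReal 0 1).real (Set.Ioi x) := by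
    have h := gaussianReal_map_neg (μ := 0) (v := 1)
    rw [neg_zero] at h
    conv_lhs => rw [← h, map_measureReal_apply measurable_neg measurableSet_Iio]
    congr 1
    ext; simp
  have hIoi : (gaussianReal 0 1).real (Set.Ioi x) = 1 - (gaussianReal 0 1).real (Set.Iic x) := by
    rw [← Set.compl_Iic, probReal_compl_eq_one_sub measurableSet_Iic]
  have hun : (gaussianReal 0 1).real (Set.Iic x) =
      (gaussianReal 0 1).real (Set.Iio (-x)) + (gaussianReal 0 1).real (Set.Icc (-x) x) := by
    rw [← measureReal_union _ measurableSet_Icc]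
    · congr 1
      ext y
      simp only [Set.mem_Iic, Set.mem_union, Set.mem_Iio, Set.mem_Icc]
      constructor
      · intro h
        rcases lt_or_ge y (-x) with h' | h'
        · exact .inl h'
        · exact .inr ⟨h', h⟩
      · rintro (h | h) <;> linarith [h]
    · rw [Set.disjoint_left]
      intro y hy hy'
      exact absurd hy'.1 (not_le.2 hy)
  rw [cdf_eq_real]
  linarith

lemma confidence_interval_iff {m μ σ K x : ℝ} (hm : 0 < m) (hσ : 0 < σ) :
    (K - σ / Real.sqrt m * x ≤ μ ∧ μ ≤ K + σ / Real.sqrt m * x) ↔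
      Real.sqrt m / σ * (K - μ) ∈ Set.Icc (-x) x := by
  have hs := Real.sqrt_pos.2 hm
  have hc : 0 < Real.sqrt m / σ := div_pos hs hσ
  have hinv : Real.sqrt m / σ * (σ / Real.sqrt m * x) = x := by field_simp
  rw [Set.mem_Icc, and_comm]
  refine and_congr ?_ ?_
  · rw [← sub_nonneg, ← mul_nonneg_iff_of_pos_left hc, mul_sub, mul_add, hinv, mul_sub]
    constructor <;> intro h <;> linarith
  · rw [← sub_nonneg, ← mul_nonneg_iff_of_pos_left hc, mul_sub, mul_sub, hinv, mul_sub]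
    constructor <;> intro h <;> linarith

theorem corollary9 {Ω : Type*} [MeasurableSpace Ω] (P : Measure Ω) [IsProbabilityMeasure P]
    (μ σ : ℝ) (hσ : 0 < σ)
    (X : ℕ → Ω → ℝ) (hX_meas : ∀ j, Measurable (X j)) (hX_indep : iIndepFun X P)
    (hX_law : ∀ j, P.map (X j) = gaussianReal μ (σ ^ 2).toNNReal)
    (L : ℕ) (hL : 1 ≤ L)
    (k : ℕ → ℕ) (hk_pos : 0 < k 1) (hk_mono : StrictMonoOn k (Set.Icc 1 (L + 1)))
    (γ : ℝ) (hγ : 0 ≤ γ)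
    (C : ℝ) (hC : 0 < C) (hμC : μ ∉ ({-C, C} : Set ℝ))
    (N : ℕ → Ω → ℕ)
    (hN : ∀ n : ℕ, 1 ≤ n → IsTrialLength P X L k (twoSidedThreshold C) γ n (N n))
    (hγμ : ¬ (γ = 1 / 2 ∧ μ = 0)) :
    Tendsto
      (fun n : ℕ => tvDist (gaussianReal 0 1)
        (P.map fun ω => Real.sqrt (N n ω : ℝ) / σ * (sampleMean X (N n) ω - μ)))
      atTop (𝓝 0) ∧
    ∀ x : ℝ, 0 < x →
      Tendsto
        (fun n : ℕ => |2 * cdf (gaussianReal 0 1) x - 1 -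
          P.real {ω | sampleMean X (N n) ω - σ / Real.sqrt (N n ω : ℝ) * x ≤ μ ∧
            μ ≤ sampleMean X (N n) ω + σ / Real.sqrt (N n ω : ℝ) * x}|)
        atTop (𝓝 0) := by
  obtain ⟨i, hi, hlim⟩ := exists_tendsto_measureReal_ne hσ hX_meas hX_indep hX_law hL hk_pos
    hk_mono hC hμC hN hγμ
  have hmeas {n : ℕ} (hn : 1 ≤ n) :
      Measurable fun ω => Real.sqrt (N n ω : ℝ) / σ * (sampleMean X (N n) ω - μ) := by
    have hNn := (hN n hn).measurable
    have h1 : Measurable fun ω => (N n ω : ℝ) := measurable_from_nat.comp hNn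
    exact (h1.sqrt.div_const σ).mul ((measurable_sampleMean hX_meas hNn).sub_const μ)
  have hbound {n : ℕ} (hn : 1 ≤ n) (A : Set ℝ) (hA : MeasurableSet A) :
      |(gaussianReal 0 1).real A -
        (P.map fun ω => Real.sqrt (N n ω : ℝ) / σ * (sampleMean X (N n) ω - μ)).real A| ≤
      P.real {ω | N n ω ≠ k i * n} := by
    have hpos : 0 < k i * n := Nat.mul_pos (strictMonoOn_Icc_one_pos hk_pos hk_mono hi) hn
    -- The standard normal law is realized on `Ω` itself, coupled with the trial through the same
    -- observations.
    rw [← map_standardizedMean hσ hX_meas hX_indep hX_law hpos]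
    refine abs_measureReal_map_sub_le (measurable_standardizedMean hX_meas μ σ _) (hmeas hn)
      (fun ω hω => ?_) hA
    have hω' : N n ω = k i * n := by simpa using hω
    simp only [standardizedMean, sampleMean, hω']
  refine ⟨squeeze_zero' (Eventually.of_forall fun n => tvDist_nonneg _ _) ?_ hlim,
    fun x hx => squeeze_zero' (Eventually.of_forall fun n => abs_nonneg _) ?_ hlim⟩
  · filter_upwards [eventually_ge_atTop 1] with n hn
    exact tvDist_le (hbound hn)
  · filter_upwards [eventually_ge_atTop 1] with n hn
    have h := hbound hn (Set.Icc (-x) x) measurableSet_Icc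
    rw [map_measureReal_apply (hmeas hn) measurableSet_Icc, gaussianReal_zero_one_real_Icc hx] at h
    -- It remains to identify the coverage event with the preimage of `[-x, x]`.
    convert h using 5
    ext ω
    obtain ⟨j, hj, hNj⟩ := (hN n hn).mem_values ω
    have hpos : (0 : ℝ) < N n ω := by
      rw [hNj]
      exact_mod_cast Nat.mul_pos (strictMonoOn_Icc_one_pos hk_pos hk_mono hj) hn
    exact confidence_interval_iff hpos hσ
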